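/- For a metric space $(X,d)$, $s>0$ and $x_1,\dots,x_n\in X$ ($n\ge 1$) let $$Z^s(x_1,\dots,x_n)=\max\Big\{\sum_{j=1}^{k-1} d(x_{i_j},x_{i_{j+1}})^s:\ 1=i_1<\dots<i_k=n\Big\},$$ and let $$\delta^s(X)=\sup\Big\{\min_{\pi\in \mathrm{Sym}(n)} Z^s(x_{\pi(1)},\dots,x_{\pi(n)}):\ x_1,\dots,x_n\in X,\ n\ge 1\Big\}\in[0,\infty].$$ A map $f$ between metric spaces is $\alpha$-Hölder if there is a finite constant $C$ with $d(f(x),f(z))\le C\,d(x,z)^\alpha$ for all $x,z$ in its domain. **Proposition 4.1.** Let $s,t>0$. Let $A$ be a compact ultrametric space with positive $t$-dimensional Hausdorff measure, $\mathcal H^t(A)>0$, and let $B$ be a nonempty compact metric space with $\delta^s(B)<\infty$. 1. There exist a compact set $A'\subset A$ and a $t/s$-Hölder map $f\colon A'\to B$ that is onto. 2. If $t=s$, then there is a Lipschitz map from $A$ onto $B$. -/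

import Mathlib

open scoped NNReal ENNReal MeasureTheory

/-- `chainZ s x` is `Z^s(x_1, …, x_n)` for the nonempty sequence `x` of `n = m + 1` points (indexed by
`0, …, m` instead of `1, …, n`): the largest value of `∑ d(x_{i_j}, x_{i_{j+1}})^s` over all strictly
increasing sequences of indices `i` that start at the first index and end at the last one.
The supremum is over a finite nonempty family, so it is a maximum. -/
noncomputable def chainZ {X : Type*} [MetricSpace X] (s : ℝ) {m : ℕ} (x : Fin (m + 1) → X) : ℝ≥0∞ :=
  ⨆ (k : ℕ) (i : Fin (k + 1) → Fin (m + 1))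
    (_ : StrictMono i ∧ i 0 = 0 ∧ i (Fin.last k) = Fin.last m),
    ∑ j : Fin k, edist (x (i j.castSucc)) (x (i j.succ)) ^ s

/-- `deltaS s X` is `δ^s(X) ∈ [0, ∞]`: the supremum, over all finite nonempty sequences of points of
`X`, of the minimum of `Z^s` over all rearrangements of the sequence. -/
noncomputable def deltaS (s : ℝ) (X : Type*) [MetricSpace X] : ℝ≥0∞ :=
  ⨆ (m : ℕ) (x : Fin (m + 1) → X), ⨅ π : Equiv.Perm (Fin (m + 1)), chainZ s (x ∘ π)

open Set Filter Metric Topology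

universe u

/-! Both spaces are compared with an interval. In `A`, balls become order-convex for a lexicographic
order, and the Hausdorff content of initial segments is a `t`-Hölder function whose range contains
an interval (`exists_holder_interval`); subadditivity suffices, so no Frostman measure is needed. In
`B`, a cheap ordering of a finite set makes the costliest chain ending at a point a bounded
coordinate `h` with `d ^ s ≤ |Δh|`; an ultrafilter limit yields one `h` on all of `B`
(`exists_expanding`). So the inverse of `h` is `1/s`-Hölder on the range of `h`, and composition
gives exponent `t/s` (`exists_holder_onto`). For `t = s`, a Lipschitz retraction of `A` onto `A'`
finishes. -/

/-! ### Hausdorff content -/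

section Content

/-- The Hausdorff content of dimension `t`: like the Hausdorff measure, but with no bound on the
diameters of the covering sets. -/
noncomputable def hausdorffContent (t : ℝ) (X : Type*) [MetricSpace X] :
    MeasureTheory.OuterMeasure X :=
  MeasureTheory.OuterMeasure.boundedBy fun s => ediam s ^ t

/-- A cover of total cost below `r ^ t` has only sets of diameter at most `r`, so it is admissible
for the Hausdorff measure at scale `r`. -/
theorem hausdorffContent_pos {X : Type*} [MetricSpace X] [MeasurableSpace X] [BorelSpace X] {t : ℝ}
    (ht : 0 < t) {s : Set X} (hs : 0 < μH[t] s) : 0 < hausdorffContent t X s := by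
  rw [pos_iff_ne_zero]
  intro h0
  refine hs.ne' ?_
  rw [MeasureTheory.Measure.hausdorffMeasure_apply]
  simp only [ENNReal.iSup_eq_zero]
  intro r hr
  refine le_antisymm (ENNReal.le_of_forall_pos_le_add fun ε hε _ => ?_) bot_le
  rw [zero_add]
  have hlt : hausdorffContent t X s < min (ε : ℝ≥0∞) (r ^ t) := by
    rw [h0]
    refine lt_min (by exact_mod_cast hε) ?_
    exact ENNReal.rpow_pos_of_nonneg hr ht.le
  rw [hausdorffContent, MeasureTheory.OuterMeasure.boundedBy_apply] at hlt
  simp only [iInf_lt_iff] at hlt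
  obtain ⟨u, hu, hlt⟩ := hlt
  refine iInf_le_of_le u (iInf_le_of_le hu (iInf_le_of_le (fun n => ?_)
    (hlt.le.trans (min_le_left _ _))))
  rcases (u n).eq_empty_or_nonempty with hn | hn
  · simp [hn]
  · have h1 : ediam (u n) ^ t ≤ r ^ t := by
      refine le_trans ?_ (hlt.le.trans (min_le_right _ _))
      refine le_trans ?_ (ENNReal.le_tsum n)
      exact le_iSup (fun _ : (u n).Nonempty => ediam (u n) ^ t) hn
    exact (ENNReal.rpow_le_rpow_iff ht).1 h1

theorem hausdorffContent_closedBall_le {A : Type*} [MetricSpace A] [IsUltrametricDist A] {t : ℝ} (ht : 0 ≤ t) (x : A) {r : ℝ} (hr : 0 ≤ r) :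
    hausdorffContent t A (closedBall x r) ≤ ENNReal.ofReal (r ^ t) := by
  refine (MeasureTheory.OuterMeasure.boundedBy_le _).trans ?_
  rw [← ENNReal.ofReal_rpow_of_nonneg hr ht]
  refine ENNReal.rpow_le_rpow (ediam_le fun y hy z hz => ?_) ht
  rw [edist_dist]
  refine ENNReal.ofReal_le_ofReal ((dist_triangle_max y x z).trans (max_le hy ?_))
  rw [dist_comm]
  exact hz

theorem hausdorffContent_ne_top {X : Type*} [MetricSpace X] [CompactSpace X] {t : ℝ} (ht : 0 ≤ t)
    (s : Set X) : hausdorffContent t X s ≠ ∞ := by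
  refine ne_top_of_le_ne_top ?_ (MeasureTheory.OuterMeasure.boundedBy_le s)
  exact ENNReal.rpow_ne_top_of_nonneg ht (isBounded_iff_ediam_ne_top.1 isBounded_of_compactSpace)

end Content

/-! ### Orders with convex balls -/

section Order

/-- In an ultrametric space, the closed balls with radii in an antitone sequence are all
order-connected for a suitable linear order, here given by a map into a linear order. -/
theorem exists_convex_code {A : Type u} [Nonempty A] [MetricSpace A] [IsUltrametricDist A] {ρ : ℕ → ℝ}
    (hρ : Antitone ρ) (hρ0 : ∀ n, 0 ≤ ρ n) :
    ∃ (L : Type u) (_ : LinearOrder L) (Φ : A → L), ∀ n x y z,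
      Φ x ≤ Φ y → Φ y ≤ Φ z → dist x z ≤ ρ n → dist x y ≤ ρ n := by
  classical
  let _ : LinearOrder A := IsWellOrder.linearOrder WellOrderingRel
  -- The representative depends only on the ball as a set, so points sharing a ball share it.
  let rep : Set A → A := fun s => if h : s.Nonempty then h.choose else Classical.choice ‹Nonempty A›
  have hrep : ∀ x n, rep (closedBall x (ρ n)) ∈ closedBall x (ρ n) := fun x n => by
    have h : (closedBall x (ρ n)).Nonempty := ⟨x, mem_closedBall_self (hρ0 n)⟩
    simp only [rep, dif_pos h]
    exact h.choose_spec
  let q : A → ℕ → A := fun x n => rep (closedBall x (ρ n))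
  have hq : ∀ x y n, q x n = q y n ↔ dist x y ≤ ρ n := fun x y n => by
    constructor
    · intro h
      have hx : dist (q x n) x ≤ ρ n := hrep x n
      have hy : dist (q y n) y ≤ ρ n := hrep y n
      rw [← h] at hy
      rw [dist_comm] at hx
      exact (dist_triangle_max x (q x n) y).trans (max_le hx hy)
    · intro h
      have : closedBall x (ρ n) = closedBall y (ρ n) :=
        IsUltrametricDist.closedBall_eq_of_mem (by rw [mem_closedBall, dist_comm]; exact h)
      simp only [q, this]
  -- If `x` and `z` share their first `n + 1` entries, so does every point lexicographically between
  -- them.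
  refine ⟨Lex (ℕ → A), inferInstance, fun x => toLex (q x), fun n x y z hxy hyz hxz => ?_⟩
  have hxz' : ∀ i ≤ n, q x i = q z i := fun i hi => (hq x z i).2 (hxz.trans (hρ hi))
  have key : ∀ i ≤ n, q x i = q y i := by
    intro i
    induction i using Nat.strong_induction_on with
    | _ i ih =>
      intro hi
      have hlt : ∀ j < i, q x j = q y j := fun j hj => ih j hj (hj.le.trans hi)
      refine le_antisymm (Pi.apply_le_of_toLex hxy hlt) ?_
      rw [hxz' i hi]
      exact Pi.apply_le_of_toLex hyz fun j hj => by rw [← hlt j hj, hxz' j (hj.le.trans hi)]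
  exact (hq x y n).1 (key n le_rfl)

variable {A L : Type*} [MetricSpace A] [CompactSpace A] [LinearOrder L]

/-- Take the `Φ`-largest point `x` of a finite `r`-net in `S`. A point at or above `x` is `r`-close
to a net point at or below `x`, and convexity places `x` in the same ball. -/
theorem exists_almost_max {Φ : A → L} [IsUltrametricDist A] {r : ℝ} (hr : 0 < r)
    (hΦ : ∀ x y z, Φ x ≤ Φ y → Φ y ≤ Φ z → dist x z ≤ r → dist x y ≤ r) {S : Set A}
    (hS : S.Nonempty) : ∃ x ∈ S, ∀ w ∈ S, Φ w < Φ x ∨ dist w x ≤ r := by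
  have htb : TotallyBounded S := isCompact_univ.totallyBounded.subset (subset_univ S)
  obtain ⟨T, hTS, hTf, hT⟩ := htb.exists_subset (dist_mem_uniformity hr)
  obtain ⟨x₀, hx₀⟩ := hS
  have hTne : T.Nonempty := by
    obtain ⟨y, hy, -⟩ := mem_iUnion₂.1 (hT hx₀)
    exact ⟨y, hy⟩
  obtain ⟨x, hx, hmax⟩ := exists_max_image T Φ hTf hTne
  refine ⟨x, hTS hx, fun w hw => ?_⟩
  obtain ⟨y, hy, hwy⟩ := mem_iUnion₂.1 (hT hw)
  have hwy' : dist w y < r := hwy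
  rcases lt_or_ge (Φ w) (Φ x) with h | h
  · exact Or.inl h
  · right
    have := hΦ y x w (hmax y hy) h (by rw [dist_comm]; exact hwy'.le)
    exact (dist_triangle_max w y x).trans (max_le hwy'.le this)

theorem exists_almost_min {Φ : A → L} [IsUltrametricDist A] {r : ℝ} (hr : 0 < r)
    (hΦ : ∀ x y z, Φ x ≤ Φ y → Φ y ≤ Φ z → dist x z ≤ r → dist x y ≤ r) {S : Set A}
    (hS : S.Nonempty) : ∃ x ∈ S, ∀ w ∈ S, Φ x < Φ w ∨ dist w x ≤ r :=
  exists_almost_max (Φ := OrderDual.toDual ∘ Φ) hr (fun x y z hxy hyz hxz =>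
    (dist_triangle_max x z y).trans (max_le hxz (hΦ z y x hyz hxy (by rwa [dist_comm])))) hS

end Order

/-! ### The Hölder function on `A` -/

/-- A compact ultrametric space of positive `t`-dimensional Hausdorff measure has a `t`-Hölder map
to the line whose range contains a nondegenerate interval. -/
theorem exists_holder_interval {A : Type*} [MetricSpace A] [CompactSpace A] [IsUltrametricDist A]
    [MeasurableSpace A] [BorelSpace A] {t : ℝ} (ht : 0 < t) (hA : 0 < μH[t] (univ : Set A)) :
    ∃ F : A → ℝ, ∃ C c : ℝ, 0 ≤ C ∧ 0 < c ∧ (∀ x y, |F x - F y| ≤ C * dist x y ^ t) ∧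
      Icc 0 c ⊆ range F := by
  have hne : Nonempty A := by
    by_contra h
    rw [not_nonempty_iff] at h
    simp [univ_eq_empty_iff.2 h] at hA
  set ν : Set A → ℝ := fun s => (hausdorffContent t A s).toReal with hν
  have hfin : ∀ s : Set A, hausdorffContent t A s ≠ ∞ := hausdorffContent_ne_top ht.le
  have hmono : ∀ {s u : Set A}, s ⊆ u → ν s ≤ ν u := fun h =>
    ENNReal.toReal_mono (hfin _) (MeasureTheory.measure_mono h)
  have hunion : ∀ s u : Set A, ν (s ∪ u) ≤ ν s + ν u := fun s u => by
    rw [hν]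
    simp only
    rw [← ENNReal.toReal_add (hfin s) (hfin u)]
    exact ENNReal.toReal_mono (ENNReal.add_ne_top.2 ⟨hfin s, hfin u⟩)
      (MeasureTheory.measure_union_le s u)
  have hball : ∀ x : A, ∀ {r : ℝ}, 0 ≤ r → ν (closedBall x r) ≤ r ^ t := fun x r hr =>
    ENNReal.toReal_le_of_le_ofReal (by positivity) (hausdorffContent_closedBall_le ht.le x hr)
  set D : ℝ := diam (univ : Set A) + 1 with hD
  have hDpos : 0 < D := by have := diam_nonneg (s := (univ : Set A)); linarith
  have hdist : ∀ x y : A, dist x y ≤ D := fun x y => by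
    have := dist_le_diam_of_mem (isBounded_of_compactSpace (s := (univ : Set A)))
      (mem_univ x) (mem_univ y)
    linarith
  set ρ : ℕ → ℝ := fun n => D * (1 / 2) ^ n with hρ
  have hρpos : ∀ n, 0 < ρ n := fun n => by positivity
  have hρanti : Antitone ρ := fun m n h =>
    mul_le_mul_of_nonneg_left (pow_le_pow_of_le_one (by norm_num) (by norm_num) h) hDpos.le
  have hρlim : Tendsto ρ atTop (𝓝 0) := by
    have := (tendsto_pow_atTop_nhds_zero_of_lt_one (r := (1 / 2 : ℝ)) (by norm_num)
      (by norm_num)).const_mul D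
    rwa [mul_zero] at this
  obtain ⟨L, _, Φ, hΦ⟩ := exists_convex_code (A := A) hρanti fun n => (hρpos n).le
  set F : A → ℝ := fun x => ν {y | Φ y < Φ x} with hF
  -- By convexity, the initial segment of `y` exceeds that of `x` only inside the ball around `x`.
  have hstep : ∀ n x y, dist x y ≤ ρ n → F y ≤ F x + ρ n ^ t := fun n x y hxy => by
    refine (hmono (u := {w | Φ w < Φ x} ∪ closedBall x (ρ n)) fun w hw => ?_).trans
      ((hunion _ _).trans (add_le_add le_rfl (hball x (hρpos n).le)))
    rcases lt_or_ge (Φ w) (Φ x) with h | h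
    · exact Or.inl h
    · right
      rw [mem_closedBall, dist_comm]
      exact hΦ n x w y h (le_of_lt hw) hxy
  have hholder : ∀ x y, F y - F x ≤ 2 ^ t * dist x y ^ t := fun x y => by
    rcases eq_or_ne x y with rfl | hxy
    · simp only [sub_self, dist_self]
      positivity
    -- Here `ρ (n + 1) < dist x y ≤ ρ n`; the ratio `2` gives the constant `2 ^ t`.
    obtain ⟨n, hn1, hn2⟩ := exists_nat_pow_near_of_lt_one (x := dist x y / D) (y := 1 / 2)
      (div_pos (dist_pos.2 hxy) hDpos) ((div_le_one hDpos).2 (hdist x y)) (by norm_num)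
      (by norm_num)
    rw [div_le_iff₀ hDpos, mul_comm] at hn2
    rw [lt_div_iff₀ hDpos, pow_succ] at hn1
    have h1 := hstep n x y hn2
    have h2 : ρ n ^ t ≤ (2 * dist x y) ^ t :=
      Real.rpow_le_rpow (hρpos n).le (by simp only [hρ]; linarith) ht.le
    rw [Real.mul_rpow (by norm_num) dist_nonneg] at h2
    linarith
  have hholder' : ∀ x y, |F x - F y| ≤ 2 ^ t * dist x y ^ t := fun x y =>
    abs_le.2 ⟨by linarith [hholder x y], by rw [dist_comm]; exact hholder y x⟩
  have hcont : Continuous F := by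
    rw [continuous_iff_continuousAt]
    intro x
    rw [ContinuousAt, tendsto_iff_dist_tendsto_zero]
    have hlim : Tendsto (fun y => 2 ^ t * dist y x ^ t) (𝓝 x) (𝓝 0) := by
      have : Continuous fun y => 2 ^ t * dist y x ^ t :=
        continuous_const.mul ((continuous_id.dist continuous_const).rpow_const fun _ => Or.inr ht.le)
      simpa [ht.ne'] using this.tendsto x
    exact squeeze_zero (fun _ => dist_nonneg) (fun y => hholder' y x) hlim
  refine ⟨F, 2 ^ t, ν univ, by positivity, ?_, hholder', fun y hy => ?_⟩
  · exact ENNReal.toReal_pos (hausdorffContent_pos ht hA).ne' (hfin _)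
  have hclosed : IsClosed (range F) := (isCompact_range hcont).isClosed
  rw [← hclosed.closure_eq, Metric.mem_closure_iff]
  intro ε hε
  have hlim : Tendsto (fun n => ρ n ^ t + ρ n ^ t) atTop (𝓝 0) := by
    have := hρlim.rpow_const (p := t) (Or.inr ht.le)
    rw [Real.zero_rpow ht.ne'] at this
    simpa using this.add this
  obtain ⟨n, hn⟩ := (hlim.eventually_lt_const hε).exists
  have hnpos : 0 < ρ n ^ t := Real.rpow_pos_of_pos (hρpos n) t
  -- Otherwise the range misses the `2ρⁿᵗ`-neighbourhood of `y`, writing `ρⁿᵗ` for `ρ n ^ t`. The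
  -- content of `{F < y}` is then at most `y - ρⁿᵗ`, and an almost minimal point beyond the gap has
  -- value at most `ρⁿᵗ` more, hence at most `y`.
  by_contra! hfar
  have hfar' : ∀ x, F x ≤ y → F x + (ρ n ^ t + ρ n ^ t) < y := fun x hx => by
    have := hfar (F x) ⟨x, rfl⟩
    rw [Real.dist_eq, abs_of_nonneg (by linarith)] at this
    linarith
  have hfar'' : ∀ x, y ≤ F x → y + (ρ n ^ t + ρ n ^ t) < F x := fun x hx => by
    have := hfar (F x) ⟨x, rfl⟩
    rw [Real.dist_eq, abs_of_nonpos (by linarith)] at this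
    linarith
  have hlow : ν {w | F w < y} + ρ n ^ t ≤ y := by
    rcases {w | F w < y}.eq_empty_or_nonempty with h | h
    · obtain ⟨z, -, hz⟩ := exists_almost_min (hρpos n) (hΦ n) (univ_nonempty (α := A))
      have hFz : F z ≤ ρ n ^ t := by
        refine (hmono fun w hw => ?_).trans (hball z (hρpos n).le)
        rcases hz w (mem_univ w) with h' | h'
        · exact absurd h' (lt_asymm hw)
        · exact h'
      have : y ≤ F z := by
        by_contra! h'
        exact (h ▸ h' : z ∈ (∅ : Set A))
      linarith [hfar'' z this, hy.1]
    · obtain ⟨x, hx, hmax⟩ := exists_almost_max (hρpos n) (hΦ n) h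
      have : ν {w | F w < y} ≤ F x + ρ n ^ t :=
        (hmono (u := {w | Φ w < Φ x} ∪ closedBall x (ρ n)) fun w hw => hmax w hw).trans
          ((hunion _ _).trans (add_le_add le_rfl (hball x (hρpos n).le)))
      linarith [hfar' x (le_of_lt hx)]
  rcases {w | y ≤ F w}.eq_empty_or_nonempty with h | h
  · have : {w | F w < y} = univ := eq_univ_of_forall fun w => by
      by_contra h'
      have hlt : ¬ F w < y := h'
      have hw : w ∈ {w | y ≤ F w} := le_of_not_gt hlt
      rw [h] at hw
      exact hw
    rw [this] at hlow
    linarith [hy.2]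
  · obtain ⟨z, hz, hmin⟩ := exists_almost_min (hρpos n) (hΦ n) h
    have : F z ≤ ν {w | F w < y} + ρ n ^ t := by
      refine (hmono (u := {w | F w < y} ∪ closedBall z (ρ n)) fun w hw => ?_).trans
          ((hunion _ _).trans (add_le_add le_rfl (hball z (hρpos n).le)))
      rcases lt_or_ge (F w) y with h' | h'
      · exact Or.inl h'
      · exact Or.inr ((hmin w h').resolve_left (lt_asymm hw))
    linarith [hfar'' z hz]

/-! ### Chains and the coordinate on `B` -/

section Chains

/-- The largest value of `∑ d(x_{i_l}, x_{i_{l+1}})^s` over all strictly increasing sequences of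
indices that start at `0` and end at `j`. -/
noncomputable def chainTo {X : Type*} [MetricSpace X] (s : ℝ) {m : ℕ} (x : Fin (m + 1) → X)
    (j : Fin (m + 1)) : ℝ≥0∞ :=
  ⨆ (k : ℕ) (i : Fin (k + 1) → Fin (m + 1)) (_ : StrictMono i ∧ i 0 = 0 ∧ i (Fin.last k) = j),
    ∑ l : Fin k, edist (x (i l.castSucc)) (x (i l.succ)) ^ s

variable {X : Type*} [MetricSpace X] {s : ℝ} {m : ℕ}

theorem chainTo_last (x : Fin (m + 1) → X) : chainTo s x (Fin.last m) = chainZ s x := rfl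

/-- Append `b` to a chain ending at `a`. This makes `chainTo` a potential whose increments dominate
the distances. -/
theorem chainTo_add_le (x : Fin (m + 1) → X) {a b : Fin (m + 1)} (hab : a < b) :
    chainTo s x a + edist (x a) (x b) ^ s ≤ chainTo s x b := by
  have key : ∀ (k : ℕ) (i : Fin (k + 1) → Fin (m + 1)),
      (StrictMono i ∧ i 0 = 0 ∧ i (Fin.last k) = a) →
      ∑ l : Fin k, edist (x (i l.castSucc)) (x (i l.succ)) ^ s + edist (x a) (x b) ^ s
        ≤ chainTo s x b := by
    rintro k i ⟨hi, hi0, hik⟩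
    let i' : Fin (k + 1 + 1) → Fin (m + 1) := Fin.snoc (α := fun _ => Fin (m + 1)) i b
    have hcs : ∀ l, i' (Fin.castSucc l) = i l := fun l =>
      Fin.snoc_castSucc (α := fun _ => Fin (m + 1)) _ _ _
    have hlast : i' (Fin.last (k + 1)) = b := Fin.snoc_last (α := fun _ => Fin (m + 1)) _ _
    have hi' : StrictMono i' := by
      rw [Fin.strictMono_iff_lt_succ]
      intro l
      induction l using Fin.lastCases with
      | last => rw [hcs, Fin.succ_last, hlast, hik]; exact hab
      | cast l => rw [hcs, Fin.succ_castSucc, hcs]; exact hi Fin.castSucc_lt_succ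
    refine le_trans (le_of_eq ?_)
      (le_iSup_of_le (k + 1) (le_iSup_of_le i' (le_iSup_of_le ⟨hi', ?_, hlast⟩ le_rfl)))
    · rw [Fin.sum_univ_castSucc]
      simp only [hcs, Fin.succ_castSucc, Fin.succ_last, hlast, hik]
    · rw [← Fin.castSucc_zero, hcs, hi0]
  have hchain : ∃ (k : ℕ) (i : Fin (k + 1) → Fin (m + 1)),
      StrictMono i ∧ i 0 = 0 ∧ i (Fin.last k) = a := by
    rcases eq_or_ne a 0 with rfl | h
    · exact ⟨0, fun _ => 0, fun p q hpq => absurd hpq (by omega), rfl, rfl⟩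
    · refine ⟨1, ![0, a], ?_, rfl, rfl⟩
      rw [Fin.strictMono_iff_lt_succ]
      intro l
      fin_cases l
      exact Fin.pos_iff_ne_zero.2 h
  -- The sign of `s` is free here, so the last term may be infinite and could not be subtracted.
  by_cases htop : edist (x a) (x b) ^ s = ∞
  · obtain ⟨k, i, hi⟩ := hchain
    have hle : edist (x a) (x b) ^ s ≤ chainTo s x b := le_add_self.trans (key k i hi)
    rw [htop, top_le_iff] at hle
    rw [hle]
    exact le_top
  obtain ⟨k, i, hi⟩ := hchain
  rw [← tsub_add_cancel_of_le (le_add_self.trans (key k i hi))]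
  refine add_le_add (iSup_le fun k => iSup_le fun i => iSup_le fun hi => ?_) le_rfl
  exact ENNReal.le_sub_of_add_le_right htop (key k i hi)

theorem chainTo_le_chainZ (x : Fin (m + 1) → X) (a : Fin (m + 1)) :
    chainTo s x a ≤ chainZ s x := by
  rw [← chainTo_last]
  rcases (Fin.le_last a).eq_or_lt with h | h
  · rw [h]
  · exact le_self_add.trans (chainTo_add_le x h)

/-- If the rearrangement constant is finite, every finite set can be placed in a fixed interval so
that the `s`-th powers of distances are at most the distances in the interval. -/
theorem exists_expanding_on_finset (hs : 0 < s) (hX : deltaS s X < ∞) (S : Finset X) :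
    ∃ h : X → ℝ, (∀ b, h b ∈ Icc 0 ((deltaS s X).toReal + 1)) ∧
      ∀ a ∈ S, ∀ b ∈ S, dist a b ^ s ≤ |h a - h b| := by
  classical
  rcases S.eq_empty_or_nonempty with rfl | hS
  · exact ⟨fun _ => 0, fun _ => ⟨le_rfl, by positivity⟩, by simp⟩
  obtain ⟨m, hm⟩ : ∃ m, S.card = m + 1 := ⟨S.card - 1, by have := hS.card_pos; omega⟩
  let e : Fin (m + 1) ≃ S := (Fin.castOrderIso hm.symm).toEquiv.trans S.equivFin.symm
  -- The `+ 1` makes the bound strict, and keeps the target interval nondegenerate when `deltaS s X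
  -- = 0`.
  have hlt : ⨅ π : Equiv.Perm (Fin (m + 1)), chainZ s ((fun i => (e i : X)) ∘ π) <
      deltaS s X + 1 :=
    lt_of_le_of_lt (le_iSup_of_le m (le_iSup
      (fun x : Fin (m + 1) → X => ⨅ π : Equiv.Perm (Fin (m + 1)), chainZ s (x ∘ π)) _))
      (ENNReal.lt_add_right hX.ne one_ne_zero)
  obtain ⟨π, hπ⟩ := iInf_lt_iff.1 hlt
  set x : Fin (m + 1) → X := (fun i => (e i : X)) ∘ π with hx
  have htop : deltaS s X + 1 ≠ ∞ := ENNReal.add_ne_top.2 ⟨hX.ne, ENNReal.one_ne_top⟩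
  have hle : ∀ a, chainTo s x a ≤ deltaS s X + 1 := fun a => (chainTo_le_chainZ x a).trans hπ.le
  have hfin : ∀ a, chainTo s x a ≠ ∞ := fun a => ne_top_of_le_ne_top htop (hle a)
  have hgap : ∀ {i j}, i < j → dist (x i) (x j) ^ s ≤ (chainTo s x j).toReal -
      (chainTo s x i).toReal := fun {i j} hij => by
    have h := ENNReal.toReal_mono (hfin j) (chainTo_add_le (s := s) x hij)
    rw [ENNReal.toReal_add (hfin i) (ENNReal.rpow_ne_top_of_nonneg hs.le (edist_ne_top _ _)),
      ← ENNReal.toReal_rpow, ← dist_edist] at h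
    linarith
  refine ⟨fun b => if hb : b ∈ S then (chainTo s x (π.symm (e.symm ⟨b, hb⟩))).toReal else 0,
    fun b => ?_, fun a ha b hb => ?_⟩
  · dsimp only
    split_ifs with hb
    · refine ⟨ENNReal.toReal_nonneg, ?_⟩
      have := ENNReal.toReal_mono htop (hle (π.symm (e.symm ⟨b, hb⟩)))
      rwa [ENNReal.toReal_add hX.ne ENNReal.one_ne_top, ENNReal.toReal_one] at this
    · exact ⟨le_rfl, by positivity⟩
  · simp only [dif_pos ha, dif_pos hb]
    set i := π.symm (e.symm ⟨a, ha⟩) with hi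
    set j := π.symm (e.symm ⟨b, hb⟩) with hj
    have hia : x i = a := by simp [hx, hi]
    have hjb : x j = b := by simp [hx, hj]
    rw [← hia, ← hjb]
    rcases lt_trichotomy i j with h | h | h
    · rw [abs_sub_comm]
      exact (hgap h).trans (le_abs_self _)
    · rw [h, dist_self, Real.zero_rpow hs.ne']
      positivity
    · rw [dist_comm]
      exact (hgap h).trans (le_abs_self _)

/-- The maps for finite sets take values in one compact interval, so they converge pointwise along
an ultrafilter finer than `atTop`; each inequality concerns two points and holds eventually. -/
theorem exists_expanding (hs : 0 < s) (hX : deltaS s X < ∞) :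
    ∃ h : X → ℝ, (∀ b, h b ∈ Icc 0 ((deltaS s X).toReal + 1)) ∧
      ∀ a b, dist a b ^ s ≤ |h a - h b| := by
  classical
  choose h hmem hexp using exists_expanding_on_finset hs hX
  let U : Ultrafilter (Finset X) := Ultrafilter.of atTop
  have hU : (U : Filter (Finset X)) ≤ atTop := Ultrafilter.of_le atTop
  have hlim : ∀ b, ∃ y ∈ Icc 0 ((deltaS s X).toReal + 1), Tendsto (fun S => h S b) U (𝓝 y) :=
    fun b => isCompact_Icc.ultrafilter_le_nhds (U.map fun S => h S b)
      (le_principal_iff.2 (show ∀ᶠ S in (U : Filter (Finset X)), h S b ∈ _ from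
        Eventually.of_forall fun S => hmem S b))
  choose g hg hgl using hlim
  refine ⟨g, hg, fun a b => ge_of_tendsto ((hgl a).sub (hgl b)).abs ?_⟩
  filter_upwards [hU (mem_atTop ({a, b} : Finset X))] with S hS
  exact hexp S a (hS (by simp)) b (hS (by simp))

end Chains

/-! ### Retraction and composition -/

/-- A nonempty closed subset of a compact ultrametric space is a Lipschitz retract. -/
theorem exists_lipschitz_retraction {A : Type*} [MetricSpace A] [IsUltrametricDist A] {K : Set A}
    (hK : IsCompact K) (hne : K.Nonempty) :
    ∃ r : A → K, LipschitzWith 1 r ∧ ∀ x : K, r x = x := by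
  classical
  let p : Set A → A := fun s => if h : (s ∩ K).Nonempty then h.choose else hne.some
  -- A nearest point of `K`, chosen through the ball alone.
  let r : A → A := fun x => p (closedBall x (infDist x K))
  have hr : ∀ x, r x ∈ closedBall x (infDist x K) ∩ K := fun x => by
    obtain ⟨y, hy, hxy⟩ := hK.exists_infDist_eq_dist hne x
    have h : (closedBall x (infDist x K) ∩ K).Nonempty :=
      ⟨y, by rw [mem_closedBall, dist_comm, hxy], hy⟩
    simp only [r, p, dif_pos h]
    exact h.choose_spec
  have hd : ∀ x y, infDist y K ≤ max (dist x y) (infDist x K) := fun x y => by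
    refine (infDist_le_dist_of_mem (hr x).2).trans
      ((dist_triangle_max y x (r x)).trans (max_le_max (dist_comm y x).le ?_))
    rw [dist_comm]
    exact (hr x).1
  refine ⟨fun x => ⟨r x, (hr x).2⟩, LipschitzWith.mk_one fun x y => ?_, fun x => ?_⟩
  · change dist (r x) (r y) ≤ dist x y
    -- Either both points move by at most `dist x y`, or they define the same ball and have the same
    -- image.
    by_cases hx : infDist x K ≤ dist x y
    · have hy : infDist y K ≤ dist x y := (hd x y).trans (max_le le_rfl hx)
      have h1 : dist (r x) x ≤ dist x y := (show _ ≤ _ from (hr x).1).trans hx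
      have h2 : dist (r y) y ≤ dist x y := (show _ ≤ _ from (hr y).1).trans hy
      rw [dist_comm] at h2
      exact (dist_triangle_max _ y _).trans (max_le
        ((dist_triangle_max _ x _).trans (max_le h1 le_rfl)) h2)
    · push Not at hx
      have hxy : infDist x K = infDist y K := by
        refine le_antisymm ?_ ((hd x y).trans (max_le hx.le le_rfl))
        have := hd y x
        rw [dist_comm] at this
        exact (le_max_iff.1 this).resolve_left (not_le.2 hx)
      have : closedBall x (infDist x K) = closedBall y (infDist y K) := by
        rw [← hxy]
        exact IsUltrametricDist.closedBall_eq_of_mem (by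
          rw [mem_closedBall, dist_comm]; exact hx.le)
      simp only [r, this, dist_self]
      exact dist_nonneg
  · have h := (hr x).1
    rw [infDist_zero_of_mem x.2, closedBall_zero] at h
    exact Subtype.ext h

/-- Composing a Hölder parametrization of an interval with a Hölder partial inverse. -/
theorem exists_holder_onto {A B : Type*} [MetricSpace A] [CompactSpace A] [MetricSpace B]
    [CompactSpace B] {t s C c D : ℝ} (ht : 0 < t) (hs : 0 < s) (hC : 0 ≤ C) (hc : 0 < c)
    (hD : 0 < D) {F : A → ℝ} (hF : ∀ x y, |F x - F y| ≤ C * dist x y ^ t)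
    (hFr : Icc 0 c ⊆ range F) {h : B → ℝ} (hh : ∀ b, h b ∈ Icc 0 D)
    (hhd : ∀ a b, dist a b ^ s ≤ |h a - h b|) :
    ∃ A' : Set A, IsCompact A' ∧ ∃ f : A' → B, Function.Surjective f ∧
      ∀ x y, dist (f x) (f y) ≤ (D / c * C) ^ s⁻¹ * dist x y ^ (t / s) := by
  -- Since `h` may be discontinuous, the domain of the composite need not be closed. The Hölder
  -- bound is a closed condition, so it survives closure and forces `R` to be a graph.
  let R : Set (A × B) := closure {p | D * F p.1 = c * h p.2}
  have hR : ∀ p ∈ R, ∀ q ∈ R, dist p.2 q.2 ^ s ≤ D / c * C * dist p.1 q.1 ^ t := by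
    have hcl : IsClosed {pq : (A × B) × (A × B) |
        dist pq.1.2 pq.2.2 ^ s ≤ D / c * C * dist pq.1.1 pq.2.1 ^ t} := by
      refine isClosed_le ?_ ?_
      · exact (by fun_prop : Continuous fun pq : (A × B) × (A × B) =>
          dist pq.1.2 pq.2.2).rpow_const fun _ => Or.inr hs.le
      · exact continuous_const.mul ((by fun_prop : Continuous fun pq : (A × B) × (A × B) =>
          dist pq.1.1 pq.2.1).rpow_const fun _ => Or.inr ht.le)
    intro p hp q hq
    have hpq : (p, q) ∈ closure ({p : A × B | D * F p.1 = c * h p.2} ×ˢ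
        {p : A × B | D * F p.1 = c * h p.2}) := by
      rw [closure_prod_eq]
      exact ⟨hp, hq⟩
    refine closure_minimal ?_ hcl hpq
    rintro ⟨p, q⟩ ⟨hp, hq⟩
    simp only [mem_ofPred_eq] at hp hq ⊢
    have hp' : h p.2 = D / c * F p.1 := by field_simp; linarith
    have hq' : h q.2 = D / c * F q.1 := by field_simp; linarith
    refine (hhd _ _).trans ?_
    rw [hp', hq', ← mul_sub, abs_mul, abs_of_pos (div_pos hD hc), mul_assoc]
    exact mul_le_mul_of_nonneg_left (hF _ _) (div_pos hD hc).le
  have hf : ∀ a : Prod.fst '' R, ∃ b, (a.1, b) ∈ R := by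
    rintro ⟨_, ⟨a, b⟩, hab, rfl⟩
    exact ⟨b, hab⟩
  choose f hf using hf
  refine ⟨Prod.fst '' R, isClosed_closure.isCompact.image continuous_fst, f, fun b => ?_,
    fun x y => ?_⟩
  · obtain ⟨a, ha⟩ := hFr (show c * h b / D ∈ Icc 0 c by
      have := hh b
      refine ⟨div_nonneg (mul_nonneg hc.le this.1) hD.le, ?_⟩
      rw [div_le_iff₀ hD]
      exact mul_le_mul_of_nonneg_left this.2 hc.le)
    have hab : (a, b) ∈ R := subset_closure (by
      simp only [mem_ofPred_eq, ha]
      field_simp)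
    refine ⟨⟨a, (a, b), hab, rfl⟩, ?_⟩
    have h0 := hR _ (hf ⟨a, (a, b), hab, rfl⟩) _ hab
    simp only [dist_self, Real.zero_rpow ht.ne', mul_zero] at h0
    by_contra hne
    exact absurd h0 (not_le.2 (Real.rpow_pos_of_pos (dist_pos.2 hne) s))
  · have h0 := hR _ (hf x) _ (hf y)
    have h1 := Real.rpow_le_rpow (by positivity) h0 (inv_pos.2 hs).le
    rw [Real.rpow_rpow_inv dist_nonneg hs.ne', Real.mul_rpow (by positivity) (by positivity),
      ← Real.rpow_mul dist_nonneg, ← div_eq_mul_inv] at h1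
    exact h1

theorem holderWith_of_dist_le {X Y : Type*} [MetricSpace X] [MetricSpace Y] {f : X → Y} {C : ℝ}
    {r : ℝ≥0} (hC : 0 ≤ C) (hf : ∀ x y, dist (f x) (f y) ≤ C * dist x y ^ (r : ℝ)) :
    HolderWith C.toNNReal r f := fun x y => by
  rw [edist_dist, edist_dist, ENNReal.ofReal_rpow_of_nonneg dist_nonneg r.coe_nonneg]
  change _ ≤ ENNReal.ofReal C * _
  rw [← ENNReal.ofReal_mul hC]
  exact ENNReal.ofReal_le_ofReal (hf x y)

theorem proposition4p1 {A : Type*} [MetricSpace A] [CompactSpace A] [IsUltrametricDist A]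
    [MeasurableSpace A] [BorelSpace A] {B : Type*} [MetricSpace B] [CompactSpace B]
    (t s : ℝ≥0) (ht : 0 < t) (hs : 0 < s)
    (hA : 0 < μH[(t : ℝ)] (Set.univ : Set A)) (hB : deltaS (s : ℝ) B < ∞) :
    (∃ A' : Set A, IsCompact A' ∧
      ∃ f : A' → B, (∃ C : ℝ≥0, HolderWith C (t / s) f) ∧ Function.Surjective f) ∧
    (t = s → Nonempty B →
      ∃ f : A → B, (∃ K : ℝ≥0, LipschitzWith K f) ∧ Function.Surjective f) := by
  have htR : (0 : ℝ) < t := ht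
  have hsR : (0 : ℝ) < s := hs
  obtain ⟨F, C, c, hC, hc, hF, hFr⟩ := exists_holder_interval htR hA
  obtain ⟨h, hh, hhd⟩ := exists_expanding hsR hB
  obtain ⟨A', hA', f, hsurj, hf⟩ :=
    exists_holder_onto htR hsR hC hc (by positivity) hF hFr hh hhd
  rw [← NNReal.coe_div] at hf
  have hholder := holderWith_of_dist_le (by positivity) hf
  refine ⟨⟨A', hA', f, ⟨_, hholder⟩, hsurj⟩, ?_⟩
  -- A point of `B` supplies the point of `A'` that the retraction needs.
  rintro rfl ⟨b⟩
  rw [div_self ht.ne', holderWith_one] at hholder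
  obtain ⟨r, hr, hrA⟩ := exists_lipschitz_retraction hA' ⟨_, (hsurj b).choose.2⟩
  refine ⟨f ∘ r, ⟨_, hholder.comp hr⟩, fun b => ?_⟩
  obtain ⟨a, ha⟩ := hsurj b
  exact ⟨a, by rw [Function.comp_apply, hrA, ha]⟩
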